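/- **Theorem 1.** Let $\mathcal H=\bigotimes_{i=1}^m\mathbb C^{d_i}$ be the Hilbert space of $m$ parties, of total dimension $D=\prod_i d_i$. Let $\{\psi_1,\dots,\psi_n\}\subset\mathcal H$ be an unextendible product basis (UPB): an orthonormal set of product vectors $\psi_j=\bigotimes_i\varphi_{i,j}$ that spans a proper subspace $\mathcal H_S$ of $\mathcal H$ and such that $\mathcal H_S^\perp$ contains no nonzero product vector. Then $$\bar\rho=\frac{1}{D-n}\Bigl(\mathbf 1-\sum_{j=1}^n|\psi_j\rangle\langle\psi_j|\Bigr)$$ is a bound entangled state, and it has positive partial transpose across every bipartite cut. That is: 1. $\bar\rho$ is a density operator (positive semidefinite, of trace one). 2. $\bar\rho$ is entangled: it is not a finite convex combination of projectors $|\varphi\rangle\langle\varphi|$ onto unit product vectors $\varphi=\bigotimes_i\varphi_i$. 3. No pure entanglement can be distilled from $\bar\rho$: for all local dimensions $\tau_1,\dots,\tau_m$ and every unit vector $\phi\in\bigotimes_i\mathbb C^{\tau_i}$ that is not a product vector there is $\varepsilon>0$ such that $\langle\phi|\Lambda(\bar\rho^{\otimes N})|\phi\rangle\le1-\varepsilon$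 for every $N$ and every channel $\Lambda$ that the $m$ parties can implement by finitely many rounds of local operations and classical communication (LOCC), party $i$ holding the $i$-th tensor factors of all $N$ copies. 4. For every set $S$ of parties, the partial transpose of $\bar\rho$ with respect to the parties in $S$ (in the standard basis) is positive semidefinite. -/

import Mathlib

open scoped Matrix ComplexOrder

noncomputable section

namespace UPB

/-- Labels of the computational product basis of `⨂ i, ℂ^(d i)`. -/
abbrev Idx {m : ℕ} (d : Fin m → ℕ) : Type := ∀ i, Fin (d i)

/-- The Hilbert space `⨂ i, ℂ^(d i)` of `m` parties with local dimensions `d i`, in coordinates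
with respect to the computational product basis. -/
abbrev Space {m : ℕ} (d : Fin m → ℕ) : Type := EuclideanSpace ℂ (Idx d)

/-- Operators on `⨂ i, ℂ^(d i)`. -/
abbrev Op {m : ℕ} (d : Fin m → ℕ) : Type := Matrix (Idx d) (Idx d) ℂ

/-- The product vector `⨂ i, v i`. -/
def tensorVec {m : ℕ} {d : Fin m → ℕ} (v : ∀ i, EuclideanSpace ℂ (Fin (d i))) : Space d :=
  WithLp.toLp 2 fun x => ∏ i, v i (x i)

/-- `ψ` is a product vector. -/
def IsProduct {m : ℕ} {d : Fin m → ℕ} (ψ : Space d) : Prop :=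
  ∃ v : ∀ i, EuclideanSpace ℂ (Fin (d i)), ψ = tensorVec v

/-- The operator `|ψ⟩⟨ψ|`. -/
def proj {m : ℕ} {d : Fin m → ℕ} (ψ : Space d) : Op d :=
  Matrix.of fun x y => ψ x * star (ψ y)

/-- An (incomplete orthogonal) product basis: orthonormal product vectors that span a proper
subspace. -/
structure IsPB {m : ℕ} {d : Fin m → ℕ} {n : ℕ} (ψ : Fin n → Space d) : Prop where
  orthonormal : Orthonormal ℂ ψ
  product : ∀ j, IsProduct (ψ j)
  incomplete : Submodule.span ℂ (Set.range ψ) ≠ ⊤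

/-- An unextendible product basis: a product basis such that the orthogonal complement of its span
contains no product state (product states are nonzero product vectors, up to normalization). -/
structure IsUPB {m : ℕ} {d : Fin m → ℕ} {n : ℕ} (ψ : Fin n → Space d) : Prop
    extends IsPB ψ where
  unextendible : ∀ φ ∈ (Submodule.span ℂ (Set.range ψ))ᗮ, IsProduct φ → φ = 0

/-- The uniform mixture `(1 - ∑ j, |ψ j⟩⟨ψ j|) / (D - n)`, where `D = ∏ i, d i`. -/
def complementaryState {m : ℕ} {d : Fin m → ℕ} {n : ℕ} (ψ : Fin n → Space d) : Op d :=
  (1 / (((∏ i, d i : ℕ) : ℂ) - (n : ℂ))) • (1 - ∑ j, proj (ψ j))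

/-- Density operators. -/
def IsDensity {m : ℕ} {d : Fin m → ℕ} (ρ : Op d) : Prop :=
  ρ.PosSemidef ∧ ρ.trace = 1

/-- (Full) separability: `ρ` is a finite mixture of pure product states. -/
def IsSeparable {m : ℕ} {d : Fin m → ℕ} (ρ : Op d) : Prop :=
  ∃ (k : ℕ) (p : Fin k → ℝ) (φ : Fin k → Space d),
    (∀ a, 0 ≤ p a) ∧ ∑ a, p a = 1 ∧ (∀ a, ‖φ a‖ = 1 ∧ IsProduct (φ a)) ∧
      ρ = ∑ a, (p a : ℂ) • proj (φ a)

/-- Partial transposition, in the computational basis, of the parties in `S`. -/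
def partialTranspose {m : ℕ} {d : Fin m → ℕ} (S : Finset (Fin m)) (ρ : Op d) : Op d :=
  Matrix.of fun x y =>
    ρ (fun i => if i ∈ S then y i else x i) (fun i => if i ∈ S then x i else y i)

/-- The product operator `⨂ i, A i`. -/
def tensorOp {m : ℕ} {d e : Fin m → ℕ} (A : ∀ i, Matrix (Fin (e i)) (Fin (d i)) ℂ) :
    Matrix (Idx e) (Idx d) ℂ :=
  Matrix.of fun x y => ∏ i, A i (x i) (y i)

/-- Finite protocols of local operations and classical communication that turn a system with local
dimensions `d` into one with local dimensions `τ`.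

In one round, some party `i` performs a local measurement with Kraus operators `A o i` (one for each
outcome `o`) and announces the outcome to all the parties; every other party `j` applies a local
isometry `A o j`, which may depend on the announced outcome; the rest of the protocol, including
the choice of the next party and its measurement, may depend on the outcome as well.
The local dimensions may change in every round. Thus local ancillas may be added (isometries), and
local subsystems may be discarded, or local channels applied, by measuring and ignoring the outcome;
a party that does nothing applies the isometry `1`. -/
inductive LOCC {m : ℕ} (τ : Fin m → ℕ) : (Fin m → ℕ) → Type
  | done : LOCC τ τ
  | round {d : Fin m → ℕ} (i : Fin m) (r : ℕ) (e : Fin r → Fin m → ℕ)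
      (A : ∀ (o : Fin r) (j : Fin m), Matrix (Fin (e o j)) (Fin (d j)) ℂ)
      (measurement : ∑ o, (A o i)ᴴ * A o i = 1)
      (isometry : ∀ o, ∀ j, j ≠ i → (A o j)ᴴ * A o j = 1)
      (next : ∀ o, LOCC τ (e o)) : LOCC τ d

/-- The quantum channel implemented by a protocol (the sum over all measurement outcomes). -/
def LOCC.apply {m : ℕ} {τ : Fin m → ℕ} : ∀ {d : Fin m → ℕ}, LOCC τ d → Op d → Op τ
  | _, .done, ρ => ρ
  | _, .round _ _ _ A _ _ next, ρ =>
      ∑ o, (next o).apply (tensorOp (A o) * ρ * (tensorOp (A o))ᴴ)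

/-- `N` copies `ρ^{⊗ N}`, as an operator on a system in which party `i` holds its `N` local systems
of dimension `d i`, i.e. the space `(ℂ^(d i))^{⊗ N} = ℂ^(d i ^ N)`. -/
def copies {m : ℕ} {d : Fin m → ℕ} (ρ : Op d) (N : ℕ) : Op (fun i => d i ^ N) :=
  Matrix.of fun x y => ∏ k : Fin N,
    ρ (fun i => finFunctionFinEquiv.symm (x i) k) (fun i => finFunctionFinEquiv.symm (y i) k)

/-- The fidelity `⟨φ|σ|φ⟩` of `σ` with the pure state `φ`. -/
def fidelity {m : ℕ} {d : Fin m → ℕ} (φ : Space d) (σ : Op d) : ℝ :=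
  (∑ x, ∑ y, star (φ x) * σ x y * φ y).re

/-- Pure entanglement can be distilled from `ρ`: for some entangled pure state `φ` of the `m`
parties (of any local dimensions), the parties can obtain `φ` with fidelity arbitrarily close to `1`
by local operations and classical communication from sufficiently many copies of `ρ`. -/
def IsDistillable {m : ℕ} {d : Fin m → ℕ} (ρ : Op d) : Prop :=
  ∃ (τ : Fin m → ℕ) (φ : Space τ), ‖φ‖ = 1 ∧ ¬ IsProduct φ ∧
    ∀ ε : ℝ, 0 < ε → ∃ (N : ℕ) (P : LOCC τ (fun i => d i ^ N)),
      1 - ε < fidelity φ (P.apply (copies ρ N))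

/-- Bound entangled states: entangled (i.e. not separable) states from which no pure entanglement
can be distilled. -/
def IsBoundEntangled {m : ℕ} {d : Fin m → ℕ} (ρ : Op d) : Prop :=
  IsDensity ρ ∧ ¬ IsSeparable ρ ∧ ¬ IsDistillable ρ

end UPB

end

namespace UPB

open Finset

/-! ### Products of vectors and operators -/

section Tensor

variable {m : ℕ} {d e : Fin m → ℕ}

/-! Partial transposition on `S` conjugates the `S`-factors of each product vector. Inner products
of product vectors factorize, so the conjugated family is still orthonormal and the partial
transpose of the state is again a positive multiple of a projector
(`IsPB.partialTranspose_posSemidef`). A separable decomposition would put a product vector into the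
orthogonal complement of the UPB (`IsUPB.not_isSeparable`).

Positivity of partial transposes survives taking copies and LOCC. A non-product pure state violates
it across some one-party cut (`minor_eq_zero`, `isProduct_of_minors`), and compactness of the states
positive across that cut bounds the fidelity away from one, uniformly in the number of copies
(`exists_fidelity_le`). -/

lemma inner_tensorVec (v w : ∀ i, EuclideanSpace ℂ (Fin (d i))) :
    inner ℂ (tensorVec v) (tensorVec w) = ∏ i, inner ℂ (v i) (w i) := by
  simp only [PiLp.inner_apply, tensorVec, Fintype.prod_sum, RCLike.inner_apply, map_prod,
    prod_mul_distrib]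

lemma tensorOp_conjTranspose (A : ∀ i, Matrix (Fin (e i)) (Fin (d i)) ℂ) :
    (tensorOp A)ᴴ = tensorOp fun i => (A i)ᴴ := by
  ext x y
  simp [tensorOp, Matrix.conjTranspose_apply]

lemma tensorOp_mul {c : Fin m → ℕ} (A : ∀ i, Matrix (Fin (e i)) (Fin (d i)) ℂ)
    (B : ∀ i, Matrix (Fin (d i)) (Fin (c i)) ℂ) :
    tensorOp A * tensorOp B = tensorOp fun i => A i * B i := by
  ext x y
  simp [tensorOp, Matrix.mul_apply, Fintype.prod_sum, prod_mul_distrib]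

lemma tensorOp_one : tensorOp (fun i => (1 : Matrix (Fin (d i)) (Fin (d i)) ℂ)) = 1 := by
  ext x y
  simp only [tensorOp, Matrix.of_apply, Matrix.one_apply]
  by_cases h : x = y
  · simp [h]
  · obtain ⟨i, hi⟩ := Function.ne_iff.1 h
    rw [if_neg h]
    exact prod_eq_zero (mem_univ i) (if_neg hi)

/-- A sum of product operators that differ in one factor only. -/
lemma sum_tensorOp {ι : Type*} [Fintype ι] (i : Fin m)
    (A : ι → ∀ j, Matrix (Fin (e j)) (Fin (d j)) ℂ) (B : ∀ j, Matrix (Fin (e j)) (Fin (d j)) ℂ)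
    (hi : ∑ o, A o i = B i) (hA : ∀ o j, j ≠ i → A o j = B j) :
    ∑ o, tensorOp (A o) = tensorOp B := by
  ext x y
  simp only [Matrix.sum_apply, tensorOp, Matrix.of_apply]
  have key (o : ι) : ∏ j, A o j (x j) (y j)
      = A o i (x i) (y i) * ∏ j ∈ univ.erase i, B j (x j) (y j) := by
    rw [← mul_prod_erase univ _ (mem_univ i)]
    congr 1
    exact prod_congr rfl fun j hj => by rw [hA o j (ne_of_mem_erase hj)]
  simp_rw [key]
  rw [← sum_mul, ← mul_prod_erase univ _ (mem_univ i), ← hi, Matrix.sum_apply]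

lemma proj_posSemidef (ψ : Space d) : (proj ψ).PosSemidef :=
  Matrix.posSemidef_vecMulVec_self_star (fun x => ψ x)

lemma trace_proj (ψ : Space d) : (proj ψ).trace = (‖ψ‖ : ℂ) ^ 2 := by
  have h := inner_self_eq_norm_sq_to_K (𝕜 := ℂ) ψ
  rw [PiLp.inner_apply] at h
  simpa [Matrix.trace, proj, Complex.mul_conj'] using h

lemma proj_mul_proj (ψ φ : Space d) :
    proj ψ * proj φ = inner ℂ ψ φ • Matrix.of fun x y => ψ x * star (φ y) := by
  ext x y
  simp only [Matrix.mul_apply, proj, Matrix.of_apply, Matrix.smul_apply, PiLp.inner_apply,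
    smul_eq_mul, RCLike.inner_apply, sum_mul]
  refine sum_congr rfl fun z _ => ?_
  simp only [starRingEnd_apply]
  ring

end Tensor

/-! ### Partial transposition -/

section PartialTranspose

variable {m : ℕ} {d e : Fin m → ℕ} (S : Finset (Fin m))

/-- The labels of the parties in `S` are taken from `y`, the other ones from `x`. -/
def mix (x y : Idx d) : Idx d := fun i => if i ∈ S then y i else x i

lemma mix_mix (x y : Idx d) : mix S (mix S x y) (mix S y x) = x := by
  funext i
  by_cases h : i ∈ S <;> simp [mix, h]

lemma partialTranspose_apply (ρ : Op d) (x y : Idx d) :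
    partialTranspose S ρ x y = ρ (mix S x y) (mix S y x) := rfl

lemma partialTranspose_sum {ι : Type*} (s : Finset ι) (ρ : ι → Op d) :
    partialTranspose S (∑ o ∈ s, ρ o) = ∑ o ∈ s, partialTranspose S (ρ o) := by
  ext x y
  simp [partialTranspose_apply, Matrix.sum_apply]

lemma partialTranspose_sub (ρ σ : Op d) :
    partialTranspose S (ρ - σ) = partialTranspose S ρ - partialTranspose S σ := rfl

lemma partialTranspose_smul (c : ℂ) (ρ : Op d) :
    partialTranspose S (c • ρ) = c • partialTranspose S ρ := rfl

lemma partialTranspose_one : partialTranspose S (1 : Op d) = 1 := by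
  ext x y
  simp only [partialTranspose_apply, Matrix.one_apply]
  congr 1
  refine propext ⟨fun h => ?_, fun h => by rw [h]⟩
  have hxy := mix_mix S x y
  rw [h] at hxy
  have hyx := mix_mix S y x
  rw [h] at hyx
  exact hxy.symm.trans hyx

lemma partialTranspose_empty (ρ : Op d) : partialTranspose ∅ ρ = ρ := by
  ext x y
  simp [partialTranspose]

/-- Partial transposition turns local operations into local operations: the ones of the parties
in `S` are complex conjugated. -/
lemma partialTranspose_tensorOp_conj (A : ∀ i, Matrix (Fin (e i)) (Fin (d i)) ℂ) (ρ : Op d) :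
    partialTranspose S (tensorOp A * ρ * (tensorOp A)ᴴ)
      = tensorOp (fun i => if i ∈ S then (A i).map star else A i) * partialTranspose S ρ
        * (tensorOp fun i => if i ∈ S then (A i).map star else A i)ᴴ := by
  ext x y
  simp only [partialTranspose_apply, Matrix.mul_apply, Matrix.conjTranspose_apply, sum_mul,
    ← Fintype.sum_prod_type']
  -- Exchanging the `S`-labels of the two summation indices is an involution on pairs; it carries
  -- one double sum to the other.
  let E : Idx d × Idx d ≃ Idx d × Idx d :=
    { toFun := fun p => (mix S p.1 p.2, mix S p.2 p.1)
      invFun := fun p => (mix S p.1 p.2, mix S p.2 p.1)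
      left_inv := fun p => by simp [mix_mix]
      right_inv := fun p => by simp [mix_mix] }
  have hE (u w : Idx d) : E (w, u) = (mix S w u, mix S u w) := rfl
  refine (Fintype.sum_equiv ((Equiv.prodComm _ _).trans (E.trans (Equiv.prodComm _ _))) _ _ ?_)
  rintro ⟨w, u⟩
  simp only [Equiv.trans_apply, Equiv.prodComm_apply, Prod.swap_prod_mk, hE, mix_mix]
  rw [mul_right_comm, mul_right_comm _ _ (star _)]
  congr 1
  simp only [tensorOp, Matrix.of_apply, star_prod, ← prod_mul_distrib]
  refine prod_congr rfl fun i _ => ?_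
  by_cases h : i ∈ S <;> simp [mix, h, mul_comm]

/-- Partial transposition complex conjugates the factors of the parties in `S`. -/
lemma partialTranspose_proj_tensorVec (v : ∀ i, EuclideanSpace ℂ (Fin (d i))) :
    partialTranspose S (proj (tensorVec v))
      = proj (tensorVec fun i => if i ∈ S then WithLp.toLp 2 fun k => star (v i k) else v i) := by
  ext x y
  simp only [partialTranspose_apply, proj, tensorVec, Matrix.of_apply, star_prod,
    ← prod_mul_distrib]
  refine prod_congr rfl fun i _ => ?_
  by_cases h : i ∈ S <;> simp [mix, h, mul_comm]

lemma inner_conj {k : ℕ} (v w : EuclideanSpace ℂ (Fin k)) :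
    inner ℂ (WithLp.toLp 2 fun a => star (v a) : EuclideanSpace ℂ (Fin k))
      (WithLp.toLp 2 fun a => star (w a)) = star (inner ℂ v w) := by
  simp [PiLp.inner_apply]

/-- Complex conjugation of some of the factors preserves orthonormality of product vectors. -/
lemma orthonormal_tensorVec_conj {n : ℕ} (v : Fin n → ∀ i, EuclideanSpace ℂ (Fin (d i)))
    (h : Orthonormal ℂ fun j => tensorVec (v j)) :
    Orthonormal ℂ fun j => tensorVec fun i =>
      if i ∈ S then (WithLp.toLp 2 fun k => star (v j i k)) else v j i := by
  have factor (j k : Fin n) (i : Fin m) :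
      inner ℂ (if i ∈ S then (WithLp.toLp 2 fun a => star (v j i a)) else v j i)
        (if i ∈ S then (WithLp.toLp 2 fun a => star (v k i a)) else v k i)
      = if i ∈ S then star (inner ℂ (v j i) (v k i)) else inner ℂ (v j i) (v k i) := by
    by_cases hi : i ∈ S
    · simp only [hi, if_true]; exact inner_conj _ _
    · simp [hi]
  rw [orthonormal_iff_ite] at h ⊢
  intro j k
  have hjk := h j k
  rw [inner_tensorVec] at hjk ⊢
  simp_rw [factor]
  by_cases hj : j = k
  · subst hj
    rw [← hjk]
    refine prod_congr rfl fun i _ => ?_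
    split_ifs
    · exact inner_conj_symm _ _
    · rfl
  · rw [if_neg hj] at hjk ⊢
    -- Orthogonality of product vectors sits in a single factor, and conjugating that factor keeps
    -- it.
    obtain ⟨i, -, hi⟩ := prod_eq_zero_iff.1 hjk
    exact prod_eq_zero (mem_univ i) (by simp [hi])

end PartialTranspose

/-! ### The complementary state -/

section ComplementaryState

variable {m : ℕ} {d : Fin m → ℕ} {n : ℕ} {ψ : Fin n → Space d}

/-- The complement of the projector onto the span of an orthonormal family. -/
lemma one_sub_sum_proj_posSemidef (h : Orthonormal ℂ ψ) : (1 - ∑ j, proj (ψ j)).PosSemidef := by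
  set P : Op d := ∑ j, proj (ψ j) with hP
  have hPP : P * P = P := by
    rw [hP, sum_mul]
    refine sum_congr rfl fun j _ => ?_
    rw [mul_sum, sum_eq_single j]
    · rw [proj_mul_proj, inner_self_eq_norm_sq_to_K, h.1 j]
      simp [proj]
    · intro k _ hk
      rw [proj_mul_proj, h.2 hk.symm, zero_smul]
    · simp
  have hPs : Pᴴ = P := (Matrix.posSemidef_sum _ fun j _ => proj_posSemidef (ψ j)).1
  have : 1 - P = (1 - P)ᴴ * (1 - P) := by
    rw [Matrix.conjTranspose_sub, hPs, Matrix.conjTranspose_one, mul_sub, mul_one, sub_mul, one_mul,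
      hPP, sub_self, sub_zero]
  rw [this]
  exact Matrix.posSemidef_conjTranspose_mul_self _

lemma IsPB.card_lt (h : IsPB ψ) : n < ∏ i, d i := by
  have h1 := finrank_span_eq_card h.orthonormal.linearIndependent
  have h2 := Submodule.finrank_lt h.incomplete
  rw [h1] at h2
  simpa using h2

lemma IsPB.coeff_pos (h : IsPB ψ) : 0 < 1 / (((∏ i, d i : ℕ) : ℂ) - (n : ℂ)) := by
  have : (0 : ℝ) < 1 / (((∏ i, d i : ℕ) : ℝ) - (n : ℝ)) :=
    one_div_pos.2 (sub_pos.2 (by exact_mod_cast h.card_lt))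
  have := Complex.zero_lt_real.2 this
  simpa only [Complex.ofReal_div, Complex.ofReal_sub, Complex.ofReal_one, Complex.ofReal_natCast]
    using this

lemma IsPB.partialTranspose_posSemidef (h : IsPB ψ) (S : Finset (Fin m)) :
    (partialTranspose S (complementaryState ψ)).PosSemidef := by
  choose v hv using h.product
  obtain rfl : ψ = fun j => tensorVec (v j) := funext hv
  rw [complementaryState, partialTranspose_smul, partialTranspose_sub, partialTranspose_one,
    partialTranspose_sum]
  simp_rw [partialTranspose_proj_tensorVec]
  exact (one_sub_sum_proj_posSemidef (orthonormal_tensorVec_conj S v h.orthonormal)).smul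
    h.coeff_pos.le

lemma IsPB.isDensity (h : IsPB ψ) : IsDensity (complementaryState ψ) := by
  refine ⟨(one_sub_sum_proj_posSemidef h.orthonormal).smul h.coeff_pos.le, ?_⟩
  have hne : ((∏ i, d i : ℕ) : ℂ) - (n : ℂ) ≠ 0 :=
    sub_ne_zero.2 (by exact_mod_cast h.card_lt.ne')
  have : (1 - ∑ j, proj (ψ j)).trace = ((∏ i, d i : ℕ) : ℂ) - (n : ℂ) := by
    rw [Matrix.trace_sub, Matrix.trace_sum, Matrix.trace_one]
    simp [trace_proj, h.orthonormal.1]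
  rw [complementaryState, Matrix.trace_smul, this, smul_eq_mul, one_div, inv_mul_cancel₀ hne]

lemma star_dotProduct (χ φ : Space d) :
    star (χ : Idx d → ℂ) ⬝ᵥ (φ : Idx d → ℂ) = inner ℂ χ φ := by
  simp [dotProduct, PiLp.inner_apply, mul_comm]

/-- `⟨χ|φ⟩⟨φ|χ⟩`. -/
lemma dotProduct_proj (χ φ : Space d) :
    star (χ : Idx d → ℂ) ⬝ᵥ (proj φ *ᵥ (χ : Idx d → ℂ)) = ((‖inner ℂ χ φ‖ ^ 2 : ℝ) : ℂ) := by
  have h1 : proj φ *ᵥ (χ : Idx d → ℂ) = inner ℂ φ χ • (φ : Idx d → ℂ) := by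
    funext x
    simp only [Matrix.mulVec, dotProduct, proj, Matrix.of_apply, Pi.smul_apply, smul_eq_mul,
      PiLp.inner_apply, RCLike.inner_apply, sum_mul, starRingEnd_apply]
    exact sum_congr rfl fun y _ => by ring
  rw [h1, dotProduct_smul, star_dotProduct, smul_eq_mul, ← inner_conj_symm φ χ, Complex.conj_mul']
  norm_cast

/-- Each `⟨ψ j|ρ|ψ j⟩` vanishes and is a sum of nonnegative terms, so a product state of nonzero
weight is orthogonal to every `ψ j`. -/
lemma IsUPB.not_isSeparable (h : IsUPB ψ) : ¬ IsSeparable (complementaryState ψ) := by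
  rintro ⟨k, p, φ, hp, hsum, hφ, hρ⟩
  have hzero (j : Fin n) :
      star (ψ j : Idx d → ℂ) ⬝ᵥ (complementaryState ψ *ᵥ (ψ j : Idx d → ℂ)) = 0 := by
    rw [complementaryState, Matrix.smul_mulVec, Matrix.sub_mulVec, Matrix.one_mulVec,
      dotProduct_smul, dotProduct_sub, Matrix.sum_mulVec, dotProduct_sum]
    simp_rw [dotProduct_proj, star_dotProduct, orthonormal_iff_ite.1 h.orthonormal]
    rw [sum_eq_single j] <;> simp +contextual [eq_comm]
  have horth (j : Fin n) (a : Fin k) : p a * ‖inner ℂ (ψ j) (φ a)‖ ^ 2 = 0 := by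
    have := hzero j
    rw [hρ, Matrix.sum_mulVec, dotProduct_sum] at this
    simp_rw [Matrix.smul_mulVec, dotProduct_smul, dotProduct_proj, smul_eq_mul] at this
    norm_cast at this
    exact (sum_eq_zero_iff_of_nonneg fun a _ => mul_nonneg (hp a) (sq_nonneg _)).1 this a
      (mem_univ a)
  obtain ⟨a, -, ha⟩ := exists_ne_zero_of_sum_ne_zero (hsum.trans_ne one_ne_zero)
  have hmem : φ a ∈ (Submodule.span ℂ (Set.range ψ))ᗮ := by
    rw [Submodule.mem_orthogonal]
    intro u hu
    induction hu using Submodule.span_induction with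
    | mem u hu =>
      obtain ⟨j, rfl⟩ := hu
      simpa [ha] using horth j a
    | zero => simp
    | add u w _ _ hu hw => rw [inner_add_left, hu, hw, add_zero]
    | smul c u _ hu => rw [inner_smul_left, hu, mul_zero]
  have := h.unextendible _ hmem (hφ a).2
  simpa [this] using (hφ a).1

/-- Without parties the space is `ℂ`, properness forces `n = 0`, and the empty product is a nonzero
product vector in the complement. -/
lemma IsUPB.parties_pos (h : IsUPB ψ) : 0 < m := by
  rcases Nat.eq_zero_or_pos m with rfl | hm
  · have hn := h.card_lt
    obtain rfl : n = 0 := by simpa using hn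
    have h0 := h.unextendible (tensorVec fun i => i.elim0) (by simp) ⟨_, rfl⟩
    have := congrArg (fun χ : Space d => χ fun i => i.elim0) h0
    simp [tensorVec] at this
  · exact hm

end ComplementaryState

/-! ### Copies and protocols preserve states with positive partial transposes -/

section Protocols

variable {m : ℕ} {d : Fin m → ℕ}

lemma partialTranspose_copies (S : Finset (Fin m)) (ρ : Op d) (N : ℕ) :
    partialTranspose S (copies ρ N) = copies (partialTranspose S ρ) N := by
  ext x y
  simp only [partialTranspose, copies, Matrix.of_apply]
  refine prod_congr rfl fun k _ => ?_
  congr 1 <;> funext i <;> split_ifs <;> rfl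

/-- Schur product theorem: a tensor power is an entrywise product of pullbacks of `ρ`. -/
lemma prod_submatrix_posSemidef {ι κ X : Type*} {ρ : Matrix ι ι ℂ} (hρ : ρ.PosSemidef)
    [Fintype X] (f : κ → X → ι) (s : Finset κ) :
    (Matrix.of fun x y => ∏ k ∈ s, ρ (f k x) (f k y)).PosSemidef := by
  classical
  induction s using Finset.induction_on with
  | empty =>
    simpa [Matrix.vecMulVec] using! Matrix.posSemidef_vecMulVec_self_star (fun _ : X => (1 : ℂ))
  | insert k s hk ih =>
    convert! (hρ.submatrix (f k)).hadamard ih using 1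
    ext x y
    simp [hk]

lemma copies_posSemidef {ρ : Op d} (hρ : ρ.PosSemidef) (N : ℕ) : (copies ρ N).PosSemidef :=
  prod_submatrix_posSemidef hρ
    (fun (k : Fin N) (x : Idx fun i => d i ^ N) i => finFunctionFinEquiv.symm (x i) k) univ

lemma trace_copies (ρ : Op d) (N : ℕ) : (copies ρ N).trace = ρ.trace ^ N := by
  let E : Idx (fun i => d i ^ N) ≃ (Fin N → Idx d) :=
    (Equiv.piCongrRight fun i => (finFunctionFinEquiv (m := d i) (n := N)).symm).trans
      (Equiv.piComm _)
  have : ρ.trace ^ N = ∏ _k : Fin N, ρ.trace := by simp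
  rw [this]
  simp only [Matrix.trace, Fintype.prod_sum]
  exact Fintype.sum_equiv E _ _ fun x => rfl

variable {τ : Fin m → ℕ}

lemma trace_apply (P : LOCC τ d) (ρ : Op d) : (P.apply ρ).trace = ρ.trace := by
  induction P with
  | done => rfl
  | @round d i r e A hmeas hiso next ih =>
    simp only [LOCC.apply, Matrix.trace_sum, ih]
    -- The isometries contribute `1`, so only the factor of the measuring party depends on the
    -- outcome.
    have key : ∑ o, (tensorOp (A o))ᴴ * tensorOp (A o) = (1 : Op d) := by
      simp_rw [tensorOp_conjTranspose, tensorOp_mul]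
      rw [← tensorOp_one]
      exact sum_tensorOp i _ _ hmeas hiso
    calc ∑ o, (tensorOp (A o) * ρ * (tensorOp (A o))ᴴ).trace
        = ∑ o, ((tensorOp (A o))ᴴ * tensorOp (A o) * ρ).trace :=
          sum_congr rfl fun o _ => by rw [Matrix.trace_mul_comm, ← Matrix.mul_assoc]
      _ = ρ.trace := by rw [← Matrix.trace_sum, ← sum_mul, key, one_mul]

/-- Each Kraus operator is a product, so after partial transposition it still acts by a congruence,
with its `S`-factors conjugated. -/
lemma apply_partialTranspose_posSemidef (S : Finset (Fin m)) (P : LOCC τ d) (ρ : Op d)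
    (hρ : (partialTranspose S ρ).PosSemidef) : (partialTranspose S (P.apply ρ)).PosSemidef := by
  induction P with
  | done => exact hρ
  | round i r e A hmeas hiso next ih =>
    rw [LOCC.apply, partialTranspose_sum]
    refine Matrix.posSemidef_sum _ fun o _ => ih o _ ?_
    rw [partialTranspose_tensorOp_conj]
    exact hρ.mul_mul_conjTranspose_same _

end Protocols

/-! ### Fidelity of states with positive partial transpose -/

section Fidelity

variable {m : ℕ} {τ : Fin m → ℕ}

/-- If the partial transposition of one party maps a pure state to a positive operator, then all
the `2 × 2` minors of its coefficients, with respect to that party and the rest, vanish. -/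
lemma minor_eq_zero {φ : Space τ} {i : Fin m}
    (h : (partialTranspose {i} (proj φ)).PosSemidef) (x y : Idx τ) :
    φ x * φ y = φ (mix {i} x y) * φ (mix {i} y x) := by
  set x' := mix {i} x y with hx'
  set y' := mix {i} y x with hy'
  -- Let `c` be the 2 × 2 matrix with rows `(φ x, φ y')` and `(φ x', φ y)`. The test vector lists
  -- the entries of `c̄ J`, where `J` has rows `(0, 1)` and `(-1, 0)`; the quadratic form is then
  -- `-2 |det c|²`.
  have h4 := (h.submatrix ![x, x', y, y']).dotProduct_mulVec_nonneg
    ![-star (φ y'), -star (φ y), star (φ x'), star (φ x)]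
  have mixes : mix {i} x x = x ∧ mix {i} x x' = x' ∧ mix {i} x' x = x ∧ mix {i} x y' = x ∧
      mix {i} y' x = y' ∧ mix {i} x' x' = x' ∧ mix {i} x' y = x' ∧ mix {i} y x' = y ∧
      mix {i} x' y' = x ∧ mix {i} y' x' = y ∧ mix {i} y y = y ∧ mix {i} y y' = y' ∧
      mix {i} y' y = y ∧ mix {i} y' y' = y' := by
    refine ⟨?_, ?_, ?_, ?_, ?_, ?_, ?_, ?_, ?_, ?_, ?_, ?_, ?_, ?_⟩ <;>
    · funext j
      by_cases hj : j = i <;> simp [x', y', mix, hj]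
  obtain ⟨m1, m2, m3, m4, m5, m6, m7, m8, m9, m10, m11, m12, m13, m14⟩ := mixes
  have expand : star ![-star (φ y'), -star (φ y), star (φ x'), star (φ x)] ⬝ᵥ
      ((partialTranspose {i} (proj φ)).submatrix ![x, x', y, y'] ![x, x', y, y'] *ᵥ
        ![-star (φ y'), -star (φ y), star (φ x'), star (φ x)])
      = -2 * ((φ x * φ y - φ x' * φ y') * star (φ x * φ y - φ x' * φ y')) := by
    simp only [dotProduct, Matrix.mulVec, Fin.sum_univ_four, Matrix.submatrix_apply, Pi.star_apply,
      partialTranspose_apply, proj, Matrix.of_apply, Matrix.cons_val, m1, m2, m3, m4, m5, m6, m7,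
      m8, m9, m10, m11, m12, m13, m14, ← hx', ← hy', star_neg, star_star, star_sub, star_mul']
    ring
  rw [expand, Complex.star_def, Complex.mul_conj] at h4
  have h5 : (0 : ℝ) ≤ -2 * Complex.normSq (φ x * φ y - φ x' * φ y') := by
    simpa using (Complex.le_def.1 h4).1
  have h6 := Complex.normSq_nonneg (φ x * φ y - φ x' * φ y')
  exact sub_eq_zero.1 (Complex.normSq_eq_zero.1 (by linarith))

/-- A vector that factorizes with respect to every single party and the rest is a product. -/
lemma isProduct_of_minors (hm : 0 < m) {φ : Space τ}
    (h : ∀ (i : Fin m) (x y : Idx τ), φ x * φ y = φ (mix {i} x y) * φ (mix {i} y x)) :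
    IsProduct φ := by
  by_cases h0 : φ = 0
  · refine ⟨fun _ => 0, ?_⟩
    ext x
    simp only [h0, tensorVec, PiLp.zero_apply]
    exact (prod_eq_zero (mem_univ (⟨0, hm⟩ : Fin m)) rfl).symm
  obtain ⟨z, hz⟩ : ∃ z, φ z ≠ 0 := by
    by_contra! hc
    exact h0 (PiLp.ext hc)
  -- The labels of `x` are replaced by those of `z` one party at a time, each at the cost of one
  -- ratio.
  have step (s : Finset (Fin m)) (x : Idx τ) :
      φ x = (∏ i ∈ s, φ (mix {i} z x) / φ z) * φ (mix s x z) := by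
    induction s using Finset.induction_on with
    | empty =>
      rw [prod_empty, one_mul]
      rfl
    | insert i s hi ih =>
      rw [ih, prod_insert hi, mul_comm (φ _ / φ z), mul_assoc]
      congr 1
      have key := h i (mix s x z) z
      have e1 : mix {i} (mix s x z) z = mix (insert i s) x z := by
        funext j
        by_cases hj : j = i <;> simp [mix, hj]
      have e2 : mix {i} z (mix s x z) = mix {i} z x := by
        funext j
        by_cases hj : j = i
        · subst hj; simp [mix, hi]
        · simp [mix, hj]
      rw [e1, e2] at key
      field_simp
      rw [key, mul_comm]
  -- The leftover scalar `φ z` is absorbed into the factor of party `0`.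
  refine ⟨fun i => WithLp.toLp 2 fun k => (if i = ⟨0, hm⟩ then φ z else 1) *
    (φ (Function.update z i k) / φ z), ?_⟩
  ext x
  have e1 : mix univ x z = z := funext fun i => if_pos (mem_univ i)
  have e2 (i : Fin m) : mix {i} z x = Function.update z i (x i) := by
    funext j
    by_cases hj : j = i
    · subst hj; simp [mix]
    · simp [mix, hj]
  rw [step univ x, e1]
  simp only [tensorVec, prod_mul_distrib, e2, prod_ite_eq', mem_univ, if_true]
  rw [mul_comm]

lemma fidelity_eq_trace (φ : Space τ) (σ : Op τ) : fidelity φ σ = (proj φ * σ).trace.re := by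
  simp only [fidelity, Matrix.trace, Matrix.diag, Matrix.mul_apply, proj, Matrix.of_apply]
  rw [sum_comm]
  refine congrArg Complex.re ?_
  exact sum_congr rfl fun x _ => sum_congr rfl fun y _ => by ring

/-- `|φ⟩⟨φ|σ|φ⟩⟨φ| = ⟨φ|σ|φ⟩ |φ⟩⟨φ|`. -/
lemma proj_mul_mul_proj (φ : Space τ) (σ : Op τ) :
    proj φ * σ * proj φ = (proj φ * σ).trace • proj φ := by
  ext x y
  simp only [Matrix.trace, Matrix.diag, Matrix.mul_apply, proj, Matrix.of_apply, Matrix.smul_apply,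
    smul_eq_mul, sum_mul]
  exact sum_congr rfl fun u _ => sum_congr rfl fun w _ => by ring

/-- A state of fidelity one with a pure state is that pure state. -/
lemma eq_proj_of_fidelity_eq_one {φ : Space τ} (hφ : ‖φ‖ = 1) (B : Op τ)
    (htr : (Bᴴ * B).trace = 1) (hF : fidelity φ (Bᴴ * B) = 1) : Bᴴ * B = proj φ := by
  set P := proj φ with hP
  have hPs : Pᴴ = P := (proj_posSemidef φ).1
  have hPP : P * P = P := by
    rw [hP, proj_mul_proj, inner_self_eq_norm_sq_to_K, hφ]
    simp [proj]
  have hherm : star (P * (Bᴴ * B)).trace = (P * (Bᴴ * B)).trace := by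
    rw [← Matrix.trace_conjTranspose, Matrix.conjTranspose_mul, hPs, Matrix.conjTranspose_mul,
      Matrix.conjTranspose_conjTranspose, Matrix.trace_mul_comm]
  have hF' : (P * (Bᴴ * B)).trace = 1 := by
    rw [fidelity_eq_trace] at hF
    rw [← Complex.conj_eq_iff_re.1 hherm, hF, Complex.ofReal_one]
  have hQQ : (1 - P) * (1 - P) = 1 - P := by
    rw [mul_sub, mul_one, sub_mul, one_mul, hPP, sub_self, sub_zero]
  -- Its squared Hilbert–Schmidt norm is `tr (BᴴB) - tr (P BᴴB) = 1 - 1`.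
  have hQ : B * (1 - P) = 0 := by
    rw [← Matrix.trace_conjTranspose_mul_self_eq_zero_iff, Matrix.conjTranspose_mul,
      Matrix.conjTranspose_sub, hPs, Matrix.conjTranspose_one, mul_assoc, Matrix.trace_mul_comm,
      mul_assoc, mul_assoc, hQQ, ← mul_assoc,
      mul_sub, mul_one, Matrix.trace_sub, Matrix.trace_mul_comm _ P, htr, hF', sub_self]
  have hBP : B * P = B := by
    rw [mul_sub, mul_one, sub_eq_zero] at hQ
    exact hQ.symm
  calc Bᴴ * B = (B * P)ᴴ * (B * P) := by rw [hBP]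
    _ = P * (Bᴴ * B) * P := by rw [Matrix.conjTranspose_mul, hPs]; simp only [mul_assoc]
    _ = P := by rw [hP, proj_mul_mul_proj, ← hP, hF', one_smul]

lemma fidelity_le_one {φ : Space τ} (hφ : ‖φ‖ = 1) (B : Op τ)
    (htr : (Bᴴ * B).trace = 1) : fidelity φ (Bᴴ * B) ≤ 1 := by
  have hQ : (1 - proj φ).PosSemidef := by
    have := one_sub_sum_proj_posSemidef (d := τ) (ψ := fun _ : Fin 1 => φ)
      ⟨fun _ => hφ, fun i j hij => (hij (Subsingleton.elim i j)).elim⟩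
    simpa using this
  have h := (hQ.mul_mul_conjTranspose_same B).trace_nonneg
  rw [Matrix.trace_mul_comm, mul_sub, mul_one, mul_sub, Matrix.trace_sub, htr,
    ← mul_assoc, Matrix.trace_mul_comm _ (proj φ)] at h
  rw [fidelity_eq_trace]
  have := (Complex.le_def.1 h).1
  simpa using this

lemma isClosed_posSemidef {ι : Type*} [Fintype ι] :
    IsClosed {M : Matrix ι ι ℂ | M.PosSemidef} := by
  simp only [Matrix.posSemidef_iff_dotProduct_mulVec, Set.ofPred_and, Set.ofPred_forall]
  refine IsClosed.inter (isClosed_eq (by fun_prop) (by fun_prop)) (isClosed_iInter fun v => ?_)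
  exact isClosed_le continuous_const (by fun_prop)

/-- The fidelity of a pure state that is entangled across the cut between party `i` and the rest
with the states that have positive partial transpose across that cut is bounded away from one. -/
lemma exists_fidelity_le {φ : Space τ} (hφ : ‖φ‖ = 1) {i : Fin m}
    (hi : ¬ (partialTranspose {i} (proj φ)).PosSemidef) :
    ∃ ε : ℝ, 0 < ε ∧ ∀ σ : Op τ, σ.PosSemidef → σ.trace = 1 →
      (partialTranspose {i} σ).PosSemidef → fidelity φ σ ≤ 1 - ε := by
  -- Writing states as `BᴴB` makes positivity automatic, and the trace condition bounds the entries
  -- of `B`.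
  let K : Set (Op τ) := {B | (Bᴴ * B).trace = 1 ∧ (partialTranspose {i} (Bᴴ * B)).PosSemidef}
  have hcont : Continuous fun B : Op τ => fidelity φ (Bᴴ * B) := by
    simp only [fidelity_eq_trace]
    fun_prop
  have hclosed : IsClosed K := by
    refine IsClosed.inter (isClosed_eq (by fun_prop) continuous_const)
      (isClosed_posSemidef.preimage (continuous_matrix fun x y => ?_))
    have : Continuous fun B : Op τ => Bᴴ * B := by fun_prop
    exact this.matrix_elem _ _
  have hsub : K ⊆ Set.univ.pi fun _ => Set.univ.pi fun _ => Metric.closedBall (0 : ℂ) 1 := by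
    rintro B ⟨hB, -⟩ x - y -
    rw [mem_closedBall_zero_iff]
    have hs : ∑ b, ∑ a, ‖B a b‖ ^ 2 = 1 := by
      have : ((∑ b, ∑ a, ‖B a b‖ ^ 2 : ℝ) : ℂ) = 1 := by
        rw [← hB]
        simp [Matrix.trace, Matrix.mul_apply, Complex.conj_mul']
      exact_mod_cast this
    have h1 : ‖B x y‖ ^ 2 ≤ 1 := by
      rw [← hs]
      exact (single_le_sum (f := fun a => ‖B a y‖ ^ 2) (fun _ _ => sq_nonneg _) (mem_univ x)).trans
        (single_le_sum (f := fun b => ∑ a, ‖B a b‖ ^ 2)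
          (fun _ _ => sum_nonneg fun _ _ => sq_nonneg _) (mem_univ y))
    exact (sq_le_one_iff₀ (norm_nonneg _)).1 h1
  have hK : IsCompact K :=
    (isCompact_univ_pi fun _ => isCompact_univ_pi fun _ => isCompact_closedBall _ _).of_isClosed_subset
      hclosed hsub
  have hroot (σ : Op τ) (h1 : σ.PosSemidef) (h2 : σ.trace = 1)
      (h3 : (partialTranspose {i} σ).PosSemidef) : ∃ B ∈ K, σ = Bᴴ * B := by
    obtain ⟨B, rfl⟩ : ∃ B : Op τ, σ = Bᴴ * B := by
      open scoped MatrixOrder in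
      exact CStarAlgebra.nonneg_iff_eq_star_mul_self.1 h1.nonneg
    exact ⟨B, ⟨h2, h3⟩, rfl⟩
  rcases K.eq_empty_or_nonempty with hempty | hne
  · refine ⟨1, one_pos, fun σ h1 h2 h3 => ?_⟩
    obtain ⟨B, hB, -⟩ := hroot σ h1 h2 h3
    simp [hempty] at hB
  · obtain ⟨B₀, hB₀, hmax⟩ := hK.exists_isMaxOn hne hcont.continuousOn
    -- The gap at the maximizer is positive: fidelity one would make the maximizer `proj φ`, which
    -- `hi` excludes.
    refine ⟨1 - fidelity φ (B₀ᴴ * B₀), sub_pos.2 ((fidelity_le_one hφ B₀ hB₀.1).lt_of_ne ?_), ?_⟩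
    · intro hF
      exact hi (eq_proj_of_fidelity_eq_one hφ B₀ hB₀.1 hF ▸ hB₀.2)
    · intro σ h1 h2 h3
      obtain ⟨B, hB, rfl⟩ := hroot σ h1 h2 h3
      rw [sub_sub_cancel]
      exact hmax hB

/-- No pure entanglement can be distilled from states whose partial transposes are positive. -/
lemma not_isDistillable (hm : 0 < m) {d : Fin m → ℕ} {ρ : Op d} (hρ : IsDensity ρ)
    (hS : ∀ S : Finset (Fin m), (partialTranspose S ρ).PosSemidef) : ¬ IsDistillable ρ := by
  rintro ⟨τ, φ, hφ, hprod, hdist⟩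
  obtain ⟨i, hi⟩ : ∃ i : Fin m, ¬ (partialTranspose {i} (proj φ)).PosSemidef := by
    by_contra! hc
    exact hprod (isProduct_of_minors hm fun i => minor_eq_zero (hc i))
  obtain ⟨ε, hε, hbound⟩ := exists_fidelity_le hφ hi
  obtain ⟨N, P, hP⟩ := hdist ε hε
  have hPS (S : Finset (Fin m)) : (partialTranspose S (P.apply (copies ρ N))).PosSemidef := by
    apply apply_partialTranspose_posSemidef
    rw [partialTranspose_copies]
    exact copies_posSemidef (hS S) N
  -- The case `S = ∅` is positivity of the output itself.
  refine hP.not_ge (hbound _ (partialTranspose_empty (P.apply _) ▸ hPS ∅) ?_ (hPS {i}))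
  rw [trace_apply, trace_copies, hρ.2, one_pow]

end Fidelity

end UPB

theorem theorem1 {m : ℕ} (d : Fin m → ℕ) {n : ℕ} (ψ : Fin n → UPB.Space d)
    (hψ : UPB.IsUPB ψ) :
    UPB.IsBoundEntangled (UPB.complementaryState ψ) ∧
      ∀ S : Finset (Fin m),
        (UPB.partialTranspose S (UPB.complementaryState ψ)).PosSemidef :=
  have hS := hψ.toIsPB.partialTranspose_posSemidef
  ⟨⟨hψ.toIsPB.isDensity, hψ.not_isSeparable,
    UPB.not_isDistillable hψ.parties_pos hψ.toIsPB.isDensity hS⟩, hS⟩
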